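/- Theorem (internodal distance PDF in 2D). Let $0<R_1<R_2$ and let $D_i\subset\mathbb R^2$ be the disk of radius $R_i$ centred at the origin. Node 1 is located at a random point $X_1\in D_1$ and node 2 at a random point $X_2\in D_2$, and $X_1,X_2$ are independent. A *static* node in $D_i$ is uniformly distributed on $D_i$. A *mobile* node in $D_i$ is one whose position has the random waypoint (RWP) density $$x\mapsto \frac{2}{\pi R_i^2}\Bigl(1-\frac{\|x\|^2}{R_i^2}\Bigr),\qquad x\in D_i,$$ i.e. its distance $\rho$ from the origin has density $\frac{4\rho}{R_i^2}\bigl(1-\frac{\rho^2}{R_i^2}\bigr)$ on $[0,R_i]$ and its direction is uniform. There are four scenarios: (s1) node 1 mobile, node 2 static; (s2) node 1 static, node 2 mobile; (s3) both mobile; (s4) both static. In each scenario the distance $\|X_1-X_2\|$ has a probability density function with respect to Lebesgue measure, given (up to null sets) by the nonnegative function $$f(r)=\begin{cases}\dfrac{2r\,q_1(r)}{R_2^2}, & 0\le r<R_2-R_1,\\[2ex] \dfrac{r}{2\pi R_1^4R_2^2}\Bigl(q_2(r)\arccos\dfrac{k_1(r)}{2rR_1}+q_3(r)\arccos\dfrac{k_2(r)}{2rR_2}+q_4(r)\Bigr),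 & R_2-R_1\le r\le R_1+R_2,\\[2ex] 0,&\text{otherwise,}\end{cases}$$ where $k_1(r)=r^2+R_1^2-R_2^2$, $k_2(r)=r^2-R_1^2+R_2^2$, and, with $g(r)=\sqrt{(r^2-(R_2-R_1)^2)((R_2+R_1)^2-r^2)}$, the functions $q_1,\dots,q_4$ are as follows. (s1) $q_1=1$, $\;q_2=4R_1^4$, $\;q_3=4R_2^2(2R_1^2-2r^2-R_2^2)$, $\;q_4=(r^2-3R_1^2+5R_2^2)\,g(r)$. (s2) $q_1=-\dfrac{2r^2+R_1^2-2R_2^2}{R_2^2}$, $\;q_2=-\dfrac{4R_1^4(2r^2+R_1^2-2R_2^2)}{R_2^2}$, $\;q_3=4R_1^2R_2^2$, $\;q_4=\dfrac{R_1^2(r^2+5R_1^2-3R_2^2)\,g(r)}{R_2^2}$. (s3) $q_1=-\dfrac{2(3r^2+R_1^2-3R_2^2)}{3R_2^2}$, $\;q_2=-\dfrac{24R_1^4(3r^2+R_1^2-3R_2^2)}{9R_2^2}$, $\;q_3=-\dfrac{24R_2^2(3r^2+R_2^2-3R_1^2)}{9}$, $\;q_4=\dfrac{2g(r)}{9R_2^2}\bigl(-r^4+8r^2(R_1^2+R_2^2)+17(R_1^4+R_2^4)-22R_1^2R_2^2\bigr)$.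 (s4) $q_1=1$, $\;q_2=4R_1^4$, $\;q_3=4R_1^2R_2^2$, $\;q_4=-4R_1^2\Bigl(\dfrac{R_1k_1(r)}{2r}\sqrt{1-\bigl(\tfrac{k_1(r)}{2rR_1}\bigr)^2}+\dfrac{R_2k_2(r)}{2r}\sqrt{1-\bigl(\tfrac{k_2(r)}{2rR_2}\bigr)^2}\Bigr)$. -/

import Mathlib

open MeasureTheory ProbabilityTheory

noncomputable section

namespace InternodalDistance

/-- The Euclidean plane. -/
abbrev Plane : Type := EuclideanSpace ℝ (Fin 2)

/-- The behaviour of a node: static, or mobile according to the random waypoint (RWP) model. -/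
inductive NodeType where
  | static
  | mobile

/-- The law of a static node in the disk of radius `R` centred at the origin:
the uniform distribution on the disk. -/
def staticLaw (R : ℝ) : Measure Plane :=
  ProbabilityTheory.cond volume (Metric.closedBall 0 R)

/-- The spatial density `2 / (π R²) * (1 - ‖x‖² / R²)` of a node moving in the disk of radius `R`
centred at the origin according to the RWP model. The distance `ρ` of such a node from the
origin has density `4 ρ / R² * (1 - ρ² / R²)` on `[0, R]`. -/
def rwpDensity (R : ℝ) (x : Plane) : ℝ :=
  2 / (Real.pi * R ^ 2) * (1 - ‖x‖ ^ 2 / R ^ 2)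

/-- The law of the position of a node which is mobile according to the RWP model in the disk of
radius `R` centred at the origin. -/
def rwpLaw (R : ℝ) : Measure Plane :=
  (volume.restrict (Metric.closedBall 0 R)).withDensity fun x => ENNReal.ofReal (rwpDensity R x)

/-- The law of the position of a node of the given type in the disk of radius `R`. -/
def nodeLaw : NodeType → ℝ → Measure Plane
  | .static, R => staticLaw R
  | .mobile, R => rwpLaw R

/-- The four deployment scenarios. Node 1 lives in the disk of radius `R₁`, node 2 in the disk of
radius `R₂`. -/
inductive Scenario where
  | s1
  | s2
  | s3
  | s4

/-- The type of node 1 (in the inner disk). -/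
def Scenario.node1 : Scenario → NodeType
  | .s1 => .mobile
  | .s2 => .static
  | .s3 => .mobile
  | .s4 => .static

/-- The type of node 2 (in the outer disk). -/
def Scenario.node2 : Scenario → NodeType
  | .s1 => .static
  | .s2 => .mobile
  | .s3 => .mobile
  | .s4 => .static

def k1 (R₁ R₂ r : ℝ) : ℝ := r ^ 2 + R₁ ^ 2 - R₂ ^ 2

def k2 (R₁ R₂ r : ℝ) : ℝ := r ^ 2 - R₁ ^ 2 + R₂ ^ 2

def g3 (R₂ ρ r : ℝ) : ℝ :=
  Real.sqrt ((r ^ 2 - (R₂ - ρ) ^ 2) * ((R₂ + ρ) ^ 2 - r ^ 2))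

def q1 (R₁ R₂ : ℝ) : Scenario → ℝ → ℝ
  | .s1, _ => 1
  | .s2, r => -((2 * r ^ 2 + R₁ ^ 2 - 2 * R₂ ^ 2) / R₂ ^ 2)
  | .s3, r => -(2 * (3 * r ^ 2 + R₁ ^ 2 - 3 * R₂ ^ 2) / (3 * R₂ ^ 2))
  | .s4, _ => 1

def q2 (R₁ R₂ : ℝ) : Scenario → ℝ → ℝ
  | .s1, _ => 4 * R₁ ^ 4
  | .s2, r => -(4 * R₁ ^ 4 * (2 * r ^ 2 + R₁ ^ 2 - 2 * R₂ ^ 2) / R₂ ^ 2)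
  | .s3, r => -(24 * R₁ ^ 4 * (3 * r ^ 2 + R₁ ^ 2 - 3 * R₂ ^ 2) / (9 * R₂ ^ 2))
  | .s4, _ => 4 * R₁ ^ 4

def q3 (R₁ R₂ : ℝ) : Scenario → ℝ → ℝ
  | .s1, r => 4 * R₂ ^ 2 * (2 * R₁ ^ 2 - 2 * r ^ 2 - R₂ ^ 2)
  | .s2, _ => 4 * R₁ ^ 2 * R₂ ^ 2
  | .s3, r => -(24 * R₂ ^ 2 * (3 * r ^ 2 + R₂ ^ 2 - 3 * R₁ ^ 2) / 9)
  | .s4, _ => 4 * R₁ ^ 2 * R₂ ^ 2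

def q4 (R₁ R₂ : ℝ) : Scenario → ℝ → ℝ
  | .s1, r => (r ^ 2 - 3 * R₁ ^ 2 + 5 * R₂ ^ 2) * g3 R₂ R₁ r
  | .s2, r => R₁ ^ 2 * (r ^ 2 + 5 * R₁ ^ 2 - 3 * R₂ ^ 2) * g3 R₂ R₁ r / R₂ ^ 2
  | .s3, r => 2 * g3 R₂ R₁ r / (9 * R₂ ^ 2) *
      (-r ^ 4 + 8 * r ^ 2 * (R₁ ^ 2 + R₂ ^ 2) + 17 * (R₁ ^ 4 + R₂ ^ 4) - 22 * R₁ ^ 2 * R₂ ^ 2)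
  | .s4, r => -4 * R₁ ^ 2 *
      (R₁ * k1 R₁ R₂ r / (2 * r) * Real.sqrt (1 - (k1 R₁ R₂ r / (2 * r * R₁)) ^ 2) +
        R₂ * k2 R₁ R₂ r / (2 * r) * Real.sqrt (1 - (k2 R₁ R₂ r / (2 * r * R₂)) ^ 2))

/-- The closed form of the density of the internodal distance (zero outside `[0, R₁ + R₂]`). -/
def distancePDF (s : Scenario) (R₁ R₂ r : ℝ) : ℝ :=
  if 0 ≤ r ∧ r < R₂ - R₁ then
    2 * r * q1 R₁ R₂ s r / R₂ ^ 2
  else if R₂ - R₁ ≤ r ∧ r ≤ R₁ + R₂ then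
    r / (2 * Real.pi * R₁ ^ 4 * R₂ ^ 2) *
      (q2 R₁ R₂ s r * Real.arccos (k1 R₁ R₂ r / (2 * r * R₁)) +
        q3 R₁ R₂ s r * Real.arccos (k2 R₁ R₂ r / (2 * r * R₂)) + q4 R₁ R₂ s r)
  else 0

end InternodalDistance

end

/-!
Write the density of each node as `a + b ‖x‖²` on its disk and `0` elsewhere
(`nodeLaw_eq_withDensity`). By independence, the substitution `v = x - y` and Tonelli, the law of
`X₁ - X₂` has the density `v ↦ ∫ F₁ x * F₂ (x - v)`. Both factors are radial, so this depends on
`‖v‖` only, and polar coordinates give the distance the density `2 π r` times the overlap integral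
at `v = (r, 0)` (`map_dist_eq_withDensity`).

The overlap integral lives on the intersection of the disk of radius `R₁` around `(0, 0)` and the
disk of radius `R₂` around `(r, 0)`. It is sliced by vertical lines. On the line at abscissa `u` the
integrand is an even polynomial in the height, integrated over a chord of half-length
`√(min (R₁² - u²) (R₂² - (u - r)²))`. The minimum changes branch at the radical line
`u = k1 / (2 r)`, so the overlap is the sum of the masses of two circular segments, one in each disk,
at signed distances `k1 / (2 r)` and `k2 / (2 r)` from the respective centres (`integral_lensSlice`).

The mass of a segment has the elementary antiderivative `α arccos (u / R) + p(u) √(R² - u²)` with a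
polynomial `p` of degree at most five (`hasDerivAt_segmentMass`, `integral_sliceMass_sqrt`). Since
`Real.arccos` is constant off `[-1, 1]` and the root of a negative number is zero, this formula is
also right when the radical line misses the disk: it gives zero or the mass of the full disk. Hence
one formula covers nested, overlapping and disjoint disks, and inserting the four choices of
coefficients gives the closed form (`distancePDF_eq_overlap`). Its nonnegativity holds because it
is `2 π r` times the integral of a nonnegative function.
-/

namespace InternodalDistance

/-! ### Masses of slices and of circular segments -/

/-- The integral over `w ∈ [-h, h]` of `(a + b (u² + w²)) (c + d ((u - r)² + w²))`: the mass which
the product of two radial densities, centred at `(0, 0)` and `(r, 0)`, puts on a vertical chord of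
half-length `h` at abscissa `u`. -/
noncomputable def sliceMass (a b c d r u h : ℝ) : ℝ :=
  2 * ((a + b * u ^ 2) * (c + d * (u - r) ^ 2)) * h +
    2 / 3 * ((a + b * u ^ 2) * d + b * (c + d * (u - r) ^ 2)) * h ^ 3 + 2 / 5 * (b * d) * h ^ 5

/-- The coefficient of the angle `arccos (u / R)` in `segmentMass`. -/
noncomputable def angleCoeff (a b c d R r : ℝ) : ℝ :=
  a * (c + d * r ^ 2) * R ^ 2 + (a * d + b * (c + d * r ^ 2)) * R ^ 4 / 2 + b * d * R ^ 6 / 3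

/-- The coefficient of the half-chord `√(R² - u²)` in `segmentMass`. -/
noncomputable def chordCoeff (a b c d R r u : ℝ) : ℝ :=
  -(2 * a * (c + d * r ^ 2) + 2 / 3 * (a * d + b * (c + d * r ^ 2)) * R ^ 2
      + 2 / 5 * (b * d) * R ^ 4) * (u / 2)
    - (4 * a * d * r + 4 / 3 * (b * d) * r * R ^ 2) * ((R ^ 2 - u ^ 2) / 3)
    + (4 / 3 * (a * d + b * (c + d * r ^ 2)) + 8 / 15 * (b * d) * R ^ 2)
      * (R ^ 2 * u / 8 - u ^ 3 / 4)
    - 8 / 3 * (b * d) * r * (2 * R ^ 4 / 15 + R ^ 2 * u ^ 2 / 15 - u ^ 4 / 5)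
    + 16 / 15 * (b * d) * (R ^ 4 * u / 16 + R ^ 2 * u ^ 3 / 24 - u ^ 5 / 6)

/-- The mass which the product of the radial densities `a + b ‖x‖²` and `c + d ‖x - (r, 0)‖²` puts
on the part of the disk of radius `R` around the origin to the right of the vertical line at
abscissa `u`. The formula needs no case distinction: for `u ≥ R` both `Real.arccos` and `√` vanish,
and for `u ≤ -R` the first is `π` and the second vanishes, which gives the mass of the disk. -/
noncomputable def segmentMass (a b c d R r u : ℝ) : ℝ :=
  angleCoeff a b c d R r * Real.arccos (u / R) + chordCoeff a b c d R r u * √(R ^ 2 - u ^ 2)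

theorem integral_sliceMass (a b c d r u h : ℝ) :
    ∫ w in -h..h, (a + b * (u ^ 2 + w ^ 2)) * (c + d * ((u - r) ^ 2 + w ^ 2))
      = sliceMass a b c d r u h := by
  have key : ∀ w ∈ Set.uIcc (-h) h, HasDerivAt (fun w => (sliceMass a b c d r u w) / 2)
      ((a + b * (u ^ 2 + w ^ 2)) * (c + d * ((u - r) ^ 2 + w ^ 2))) w := by
    intro w _
    unfold sliceMass
    have := ((((hasDerivAt_id w).const_mul (2 * ((a + b * u ^ 2) * (c + d * (u - r) ^ 2)))).add
      (((hasDerivAt_pow 3 w).const_mul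
        (2 / 3 * ((a + b * u ^ 2) * d + b * (c + d * (u - r) ^ 2)))))).add
      ((hasDerivAt_pow 5 w).const_mul (2 / 5 * (b * d)))).div_const 2
    refine this.congr_deriv ?_
    push_cast
    ring
  rw [intervalIntegral.integral_eq_sub_of_hasDerivAt key
    (Continuous.intervalIntegrable (by fun_prop) _ _)]
  unfold sliceMass
  ring

/-- Reflecting the abscissa in the midpoint of the two centres swaps the two densities. -/
theorem sliceMass_swap (a b c d r u h : ℝ) :
    sliceMass c d a b r (r - u) h = sliceMass a b c d r u h := by
  unfold sliceMass
  ring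

@[simp]
theorem sliceMass_zero (a b c d r u : ℝ) : sliceMass a b c d r u 0 = 0 := by
  simp [sliceMass]

theorem sliceMass_nonneg {a b c d r u h : ℝ} (hh : 0 ≤ h)
    (h1 : ∀ w, w ^ 2 ≤ h ^ 2 → 0 ≤ a + b * (u ^ 2 + w ^ 2))
    (h2 : ∀ w, w ^ 2 ≤ h ^ 2 → 0 ≤ c + d * ((u - r) ^ 2 + w ^ 2)) :
    0 ≤ sliceMass a b c d r u h := by
  rw [← integral_sliceMass]
  refine intervalIntegral.integral_nonneg (by linarith) fun w hw => ?_
  have : w ^ 2 ≤ h ^ 2 := sq_le_sq' hw.1 hw.2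
  exact mul_nonneg (h1 w this) (h2 w this)

theorem continuous_segmentMass (a b c d R r : ℝ) : Continuous (segmentMass a b c d R r) := by
  unfold segmentMass chordCoeff
  have : Continuous Real.arccos := Real.continuous_arccos
  fun_prop

theorem segmentMass_of_le {a b c d R r u : ℝ} (hR : 0 < R) (hu : R ≤ u) :
    segmentMass a b c d R r u = 0 := by
  have h1 : Real.arccos (u / R) = 0 := Real.arccos_eq_zero.2 ((one_le_div hR).2 hu)
  have h2 : √(R ^ 2 - u ^ 2) = 0 := Real.sqrt_eq_zero_of_nonpos (by nlinarith)
  simp [segmentMass, h1, h2]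

theorem segmentMass_of_le_neg {a b c d R r u : ℝ} (hR : 0 < R) (hu : u ≤ -R) :
    segmentMass a b c d R r u = angleCoeff a b c d R r * Real.pi := by
  have h1 : Real.arccos (u / R) = Real.pi :=
    Real.arccos_eq_pi.2 ((div_le_iff₀ hR).2 (by linarith))
  have h2 : √(R ^ 2 - u ^ 2) = 0 := Real.sqrt_eq_zero_of_nonpos (by nlinarith)
  simp [segmentMass, h1, h2]

theorem hasDerivAt_chordCoeff (a b c d R r u : ℝ) :
    HasDerivAt (chordCoeff a b c d R r)
      (-(2 * a * (c + d * r ^ 2) + 2 / 3 * (a * d + b * (c + d * r ^ 2)) * R ^ 2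
          + 2 / 5 * (b * d) * R ^ 4) * (1 / 2)
        - (4 * a * d * r + 4 / 3 * (b * d) * r * R ^ 2) * (-(2 * u) / 3)
        + (4 / 3 * (a * d + b * (c + d * r ^ 2)) + 8 / 15 * (b * d) * R ^ 2)
          * (R ^ 2 / 8 - 3 * u ^ 2 / 4)
        - 8 / 3 * (b * d) * r * (R ^ 2 * (2 * u) / 15 - 4 * u ^ 3 / 5)
        + 16 / 15 * (b * d) * (R ^ 4 / 16 + R ^ 2 * (3 * u ^ 2) / 24 - 5 * u ^ 4 / 6)) u := by
  unfold chordCoeff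
  have h1 := hasDerivAt_id' u
  have p2 := hasDerivAt_pow 2 u
  have p3 := hasDerivAt_pow 3 u
  have p4 := hasDerivAt_pow 4 u
  have p5 := hasDerivAt_pow 5 u
  have := (((((h1.div_const 2).const_mul (-(2 * a * (c + d * r ^ 2)
      + 2 / 3 * (a * d + b * (c + d * r ^ 2)) * R ^ 2 + 2 / 5 * (b * d) * R ^ 4))).sub
    (((p2.const_sub (R ^ 2)).div_const 3).const_mul
      (4 * a * d * r + 4 / 3 * (b * d) * r * R ^ 2))).add
    ((((h1.const_mul (R ^ 2)).div_const 8).sub (p3.div_const 4)).const_mul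
      (4 / 3 * (a * d + b * (c + d * r ^ 2)) + 8 / 15 * (b * d) * R ^ 2))).sub
    (((((p2.const_mul (R ^ 2)).div_const 15).const_add (2 * R ^ 4 / 15)).sub
      (p4.div_const 5)).const_mul (8 / 3 * (b * d) * r))).add
    (((((h1.const_mul (R ^ 4)).div_const 16).add ((p3.const_mul (R ^ 2)).div_const 24)).sub
      (p5.div_const 6)).const_mul (16 / 15 * (b * d)))
  refine this.congr_deriv ?_
  push_cast
  ring

/-- Moving the line to the right removes the slice on it. Beyond `±R` the segment mass is locally
constant, and the slice has length `√(R² - u²) = 0`. -/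
theorem hasDerivAt_segmentMass {a b c d R r u : ℝ} (hR : 0 < R) (hu : u ≠ R) (hu' : u ≠ -R) :
    HasDerivAt (segmentMass a b c d R r) (-sliceMass a b c d r u √(R ^ 2 - u ^ 2)) u := by
  have hne : R ^ 2 - u ^ 2 ≠ 0 := by
    have : (R - u) * (R + u) ≠ 0 :=
      mul_ne_zero (sub_ne_zero.2 hu.symm) fun h => hu' (by linarith)
    intro h
    exact this (by linarith [h, show (R - u) * (R + u) = R ^ 2 - u ^ 2 by ring])
  have harccos := (Real.hasDerivAt_arccos (x := u / R)
    (fun h => hu' (by rw [div_eq_iff hR.ne'] at h; linarith))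
    (fun h => hu (by rw [div_eq_iff hR.ne'] at h; linarith))).comp u
      ((hasDerivAt_id' u).div_const R)
  have hsqrt := ((hasDerivAt_pow 2 u).const_sub (R ^ 2)).sqrt hne
  have h := (harccos.const_mul (angleCoeff a b c d R r)).add
    ((hasDerivAt_chordCoeff a b c d R r u).mul hsqrt)
  have hs : √(1 - (u / R) ^ 2) = √(R ^ 2 - u ^ 2) / R := by
    rw [show 1 - (u / R) ^ 2 = (R ^ 2 - u ^ 2) / R ^ 2 by field_simp, Real.sqrt_div' _ (sq_nonneg R),
      Real.sqrt_sq hR.le]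
  rw [hs] at h
  refine h.congr_deriv ?_
  rcases lt_or_gt_of_ne hne with hneg | hpos
  · simp [Real.sqrt_eq_zero_of_nonpos hneg.le]
  · have hsq : √(R ^ 2 - u ^ 2) ^ 2 = R ^ 2 - u ^ 2 := Real.sq_sqrt hpos.le
    have hs0 : √(R ^ 2 - u ^ 2) ≠ 0 := (Real.sqrt_pos.2 hpos).ne'
    -- with `t` for the root, even powers of `t` are eliminated by hand: after clearing the
    -- denominator `t`, the identity is one of polynomials in `u`
    generalize √(R ^ 2 - u ^ 2) = t at hsq hs0
    have h4 : t ^ 4 = (R ^ 2 - u ^ 2) ^ 2 := by rw [← hsq]; ring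
    have h6 : t ^ 6 = (R ^ 2 - u ^ 2) ^ 3 := by rw [← hsq]; ring
    have hl : sliceMass a b c d r u t =
        (2 * ((a + b * u ^ 2) * (c + d * (u - r) ^ 2)) * (R ^ 2 - u ^ 2)
          + 2 / 3 * ((a + b * u ^ 2) * d + b * (c + d * (u - r) ^ 2)) * (R ^ 2 - u ^ 2) ^ 2
          + 2 / 5 * (b * d) * (R ^ 2 - u ^ 2) ^ 3) / t := by
      rw [← h6, ← h4, ← hsq, eq_div_iff hs0]
      unfold sliceMass
      ring
    rw [hl]
    have hR' := hR.ne'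
    unfold angleCoeff chordCoeff
    rw [← sub_eq_zero]
    field_simp
    rw [hsq]
    ring

/-- The endpoints `±R`, where `segmentMass` is not differentiable, are negligible for the
fundamental theorem of calculus. -/
theorem integral_sliceMass_sqrt {a b c d R r u v : ℝ} (hR : 0 < R) (hv : R ≤ v) :
    ∫ x in u..v, sliceMass a b c d r x √(R ^ 2 - x ^ 2) = segmentMass a b c d R r u := by
  have hc : Continuous fun x => sliceMass a b c d r x √(R ^ 2 - x ^ 2) := by
    unfold sliceMass
    fun_prop
  have h := integral_eq_of_hasDerivAt_off_countable (a := u) (b := v)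
    (segmentMass a b c d R r) (fun x => -sliceMass a b c d r x √(R ^ 2 - x ^ 2))
    (s := {R, -R}) (Set.toFinite _).countable (continuous_segmentMass a b c d R r).continuousOn
    (fun x hx => hasDerivAt_segmentMass hR (fun h => hx.2 (by simp [h]))
      (fun h => hx.2 (by simp [h]))) (hc.neg.intervalIntegrable _ _)
  rw [intervalIntegral.integral_neg, segmentMass_of_le hR hv] at h
  linarith

/-! ### The mass of the intersection of two disks -/

/-- A radial density which on the disk of radius `R` is affine in the square `t` of the distance to
the centre, and which vanishes off the disk. The argument is `t`, not the distance. -/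
noncomputable def radialDensity (a b R t : ℝ) : ℝ :=
  if t ≤ R ^ 2 then a + b * t else 0

theorem measurable_radialDensity (a b R : ℝ) : Measurable (radialDensity a b R) :=
  Measurable.ite measurableSet_Iic (by fun_prop) measurable_const

/-- The mass which the product of two `radialDensity`s centred at `(0, 0)`, `(r, 0)` puts on the line
at abscissa `u`. Where the line misses the intersection of the disks the minimum is at most zero,
and then so is its square root. -/
noncomputable def lensSlice (a b c d R₁ R₂ r u : ℝ) : ℝ :=
  sliceMass a b c d r u √(min (R₁ ^ 2 - u ^ 2) (R₂ ^ 2 - (u - r) ^ 2))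

theorem continuous_lensSlice (a b c d R₁ R₂ r : ℝ) :
    Continuous (lensSlice a b c d R₁ R₂ r) := by
  unfold lensSlice sliceMass
  fun_prop

theorem lensSlice_eq_zero {a b c d R₁ R₂ r u : ℝ} (hu : R₁ ^ 2 ≤ u ^ 2) :
    lensSlice a b c d R₁ R₂ r u = 0 := by
  have : √(min (R₁ ^ 2 - u ^ 2) (R₂ ^ 2 - (u - r) ^ 2)) = 0 :=
    Real.sqrt_eq_zero_of_nonpos ((min_le_left _ _).trans (by linarith))
  rw [lensSlice, this, sliceMass_zero]

theorem lensSlice_nonneg {a b c d R₁ R₂ : ℝ} (h1 : ∀ t, 0 ≤ t → t ≤ R₁ ^ 2 → 0 ≤ a + b * t)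
    (h2 : ∀ t, 0 ≤ t → t ≤ R₂ ^ 2 → 0 ≤ c + d * t) (r u : ℝ) :
    0 ≤ lensSlice a b c d R₁ R₂ r u := by
  rcases le_or_gt (min (R₁ ^ 2 - u ^ 2) (R₂ ^ 2 - (u - r) ^ 2)) 0 with h | h
  · rw [lensSlice, Real.sqrt_eq_zero_of_nonpos h, sliceMass_zero]
  · refine sliceMass_nonneg (Real.sqrt_nonneg _) (fun w hw => h1 _ (by positivity) ?_)
      (fun w hw => h2 _ (by positivity) ?_) <;> rw [Real.sq_sqrt h.le, le_min_iff] at hw <;>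
      linarith [hw.1, hw.2]

theorem lintegral_radialDensity_mul {a b c d R₁ R₂ : ℝ}
    (h1 : ∀ t, 0 ≤ t → t ≤ R₁ ^ 2 → 0 ≤ a + b * t)
    (h2 : ∀ t, 0 ≤ t → t ≤ R₂ ^ 2 → 0 ≤ c + d * t) (r u : ℝ) :
    ∫⁻ w, ENNReal.ofReal (radialDensity a b R₁ (u ^ 2 + w ^ 2)) *
        ENNReal.ofReal (radialDensity c d R₂ ((u - r) ^ 2 + w ^ 2))
      = ENNReal.ofReal (lensSlice a b c d R₁ R₂ r u) := by
  unfold lensSlice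
  have hmem : ∀ w : ℝ, u ^ 2 + w ^ 2 ≤ R₁ ^ 2 ∧ (u - r) ^ 2 + w ^ 2 ≤ R₂ ^ 2 ↔
      w ^ 2 ≤ min (R₁ ^ 2 - u ^ 2) (R₂ ^ 2 - (u - r) ^ 2) := by
    intro w
    rw [le_min_iff]
    constructor <;> rintro ⟨h, h'⟩ <;> constructor <;> linarith
  generalize min (R₁ ^ 2 - u ^ 2) (R₂ ^ 2 - (u - r) ^ 2) = m at hmem
  have hout : ∀ w : ℝ, ¬ w ^ 2 ≤ m → ENNReal.ofReal (radialDensity a b R₁ (u ^ 2 + w ^ 2)) *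
      ENNReal.ofReal (radialDensity c d R₂ ((u - r) ^ 2 + w ^ 2)) = 0 := by
    intro w hw
    rw [← hmem, not_and_or] at hw
    rcases hw with hw | hw <;> simp [radialDensity, hw]
  -- for `m < 0` the line misses the lens, but `Set.Icc (-√m) √m` is `{0}`, not empty
  rcases lt_or_ge m 0 with hm | hm
  · rw [Real.sqrt_eq_zero_of_nonpos hm.le, sliceMass_zero, ENNReal.ofReal_zero]
    refine (lintegral_congr fun w => hout w ?_).trans lintegral_zero
    nlinarith [sq_nonneg w]
  · have hind : ∀ w : ℝ, ENNReal.ofReal (radialDensity a b R₁ (u ^ 2 + w ^ 2)) *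
        ENNReal.ofReal (radialDensity c d R₂ ((u - r) ^ 2 + w ^ 2)) =
        (Set.Icc (-√m) √m).indicator (fun w => ENNReal.ofReal
          ((a + b * (u ^ 2 + w ^ 2)) * (c + d * ((u - r) ^ 2 + w ^ 2)))) w := by
      intro w
      have hsq : w ^ 2 ≤ m ↔ w ∈ Set.Icc (-√m) √m := Real.sq_le hm
      by_cases hw : w ^ 2 ≤ m
      · have hw' := (hmem w).2 hw
        rw [Set.indicator_of_mem (hsq.1 hw), radialDensity, radialDensity,
          if_pos hw'.1, if_pos hw'.2, ENNReal.ofReal_mul (h1 _ (by positivity) hw'.1)]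
      · rw [hout w hw, Set.indicator_of_notMem fun h => hw (hsq.2 h)]
    rw [lintegral_congr hind, lintegral_indicator measurableSet_Icc, ← integral_sliceMass,
      intervalIntegral.integral_of_le (by linarith [Real.sqrt_nonneg m]),
      ← integral_Icc_eq_integral_Ioc, ofReal_integral_eq_lintegral_ofReal]
    · exact Continuous.integrableOn_Icc (by fun_prop)
    · filter_upwards [ae_restrict_mem measurableSet_Icc] with w hw
      have hw' := (hmem w).2 ((Real.sq_le hm).2 hw)
      exact mul_nonneg (h1 _ (by positivity) hw'.1) (h2 _ (by positivity) hw'.2)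

/-- The lens is cut along the radical line of the two circles, at abscissa `k1 R₁ R₂ r / (2 * r)`.
To its right the first circle bounds the slices, to its left the second one does; reflection turns
the left part into a segment of the second disk as well. -/
theorem integral_lensSlice {a b c d R₁ R₂ r : ℝ} (hR₁ : 0 < R₁) (hR₂ : 0 < R₂) (hr : 0 < r) :
    ∫ u, lensSlice a b c d R₁ R₂ r u =
      segmentMass a b c d R₁ r (k1 R₁ R₂ r / (2 * r)) +
        segmentMass c d a b R₂ r (k2 R₁ R₂ r / (2 * r)) := by
  set p := k1 R₁ R₂ r / (2 * r) with hp
  have hpr : 2 * r * p = r ^ 2 + R₁ ^ 2 - R₂ ^ 2 := by rw [hp, k1]; field_simp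
  have hq : k2 R₁ R₂ r / (2 * r) = r - p := by rw [hp, k1, k2]; field_simp; ring
  rw [hq]
  set N := R₁ + R₂ + |p| with hN
  have hpN := abs_le.1 (show |p| ≤ N by linarith)
  have hsupp : ∀ u, u ∉ Set.Ioc (-N) N → lensSlice a b c d R₁ R₂ r u = 0 := by
    intro u hu
    refine lensSlice_eq_zero (sq_le_sq.2 ?_)
    rw [abs_of_pos hR₁]
    by_contra! hlt
    have := abs_lt.1 hlt
    have hp0 := abs_nonneg p
    exact hu ⟨by linarith [this.1], by linarith [this.2]⟩
  have hJ := continuous_lensSlice a b c d R₁ R₂ r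
  rw [← setIntegral_eq_integral_of_forall_compl_eq_zero hsupp,
    ← intervalIntegral.integral_of_le (by linarith [hpN.1, hpN.2]),
    ← intervalIntegral.integral_add_adjacent_intervals (hJ.intervalIntegrable (-N) p)
      (hJ.intervalIntegrable p N), add_comm]
  congr 1
  · rw [← integral_sliceMass_sqrt hR₁ (v := N) (by linarith [abs_nonneg p])]
    refine intervalIntegral.integral_congr fun u hu => ?_
    rw [Set.uIcc_of_le hpN.2] at hu
    have := mul_le_mul_of_nonneg_left hu.1 (by linarith : 0 ≤ 2 * r)
    simp only [lensSlice]
    rw [min_eq_left (by nlinarith)]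
  · rw [← integral_sliceMass_sqrt hR₂ (v := r - -N) (by linarith [abs_nonneg p]),
      ← intervalIntegral.integral_comp_sub_left
        (fun x => sliceMass c d a b r x √(R₂ ^ 2 - x ^ 2))]
    refine intervalIntegral.integral_congr fun u hu => ?_
    rw [Set.uIcc_of_le hpN.1] at hu
    have := mul_le_mul_of_nonneg_left hu.2 (by linarith : 0 ≤ 2 * r)
    simp only [lensSlice]
    rw [min_eq_right (by nlinarith), sliceMass_swap, show (r - u) ^ 2 = (u - r) ^ 2 by ring]

theorem segmentMass_add_nonneg {a b c d R₁ R₂ r : ℝ} (hR₁ : 0 < R₁) (hR₂ : 0 < R₂) (hr : 0 < r)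
    (h1 : ∀ t, 0 ≤ t → t ≤ R₁ ^ 2 → 0 ≤ a + b * t)
    (h2 : ∀ t, 0 ≤ t → t ≤ R₂ ^ 2 → 0 ≤ c + d * t) :
    0 ≤ segmentMass a b c d R₁ r (k1 R₁ R₂ r / (2 * r)) +
      segmentMass c d a b R₂ r (k2 R₁ R₂ r / (2 * r)) := by
  rw [← integral_lensSlice hR₁ hR₂ hr]
  exact integral_nonneg fun u => lensSlice_nonneg h1 h2 r u

theorem lintegral_lensSlice {a b c d R₁ R₂ r : ℝ} (hR₁ : 0 < R₁) (hR₂ : 0 < R₂) (hr : 0 < r)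
    (h1 : ∀ t, 0 ≤ t → t ≤ R₁ ^ 2 → 0 ≤ a + b * t)
    (h2 : ∀ t, 0 ≤ t → t ≤ R₂ ^ 2 → 0 ≤ c + d * t) :
    ∫⁻ u, ENNReal.ofReal (lensSlice a b c d R₁ R₂ r u) =
      ENNReal.ofReal (segmentMass a b c d R₁ r (k1 R₁ R₂ r / (2 * r)) +
        segmentMass c d a b R₂ r (k2 R₁ R₂ r / (2 * r))) := by
  have hint : Integrable (lensSlice a b c d R₁ R₂ r) := by
    refine (continuous_lensSlice a b c d R₁ R₂ r).integrable_of_hasCompactSupport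
      (HasCompactSupport.intro (isCompact_Icc (a := -R₁) (b := R₁)) fun u hu => ?_)
    refine lensSlice_eq_zero (sq_le_sq.2 ?_)
    rw [abs_of_pos hR₁]
    by_contra! hlt
    exact hu (abs_le.1 hlt.le)
  rw [← integral_lensSlice hR₁ hR₂ hr, ofReal_integral_eq_lintegral_ofReal hint
    (Filter.Eventually.of_forall fun u => lensSlice_nonneg h1 h2 r u)]

theorem lintegral_plane_eq_lintegral_lintegral {f : ℝ × ℝ → ENNReal} (hf : Measurable f) :
    ∫⁻ x : Plane, f (x 0, x 1) = ∫⁻ u, ∫⁻ w, f (u, w) := by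
  have hmp := (volume_preserving_finTwoArrow ℝ).comp
    (EuclideanSpace.volume_preserving_symm_measurableEquiv_toLp (Fin 2))
  have h := hmp.lintegral_comp hf
  rw [Measure.volume_eq_prod, lintegral_prod _ hf.aemeasurable] at h
  exact h

theorem lintegral_radialDensity_mul_translate {a b c d R₁ R₂ r : ℝ} (hR₁ : 0 < R₁) (hR₂ : 0 < R₂)
    (hr : 0 < r) (h1 : ∀ t, 0 ≤ t → t ≤ R₁ ^ 2 → 0 ≤ a + b * t)
    (h2 : ∀ t, 0 ≤ t → t ≤ R₂ ^ 2 → 0 ≤ c + d * t) :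
    ∫⁻ x : Plane, ENNReal.ofReal (radialDensity a b R₁ (‖x‖ ^ 2)) *
        ENNReal.ofReal (radialDensity c d R₂ (‖x - !₂[r, 0]‖ ^ 2)) =
      ENNReal.ofReal (segmentMass a b c d R₁ r (k1 R₁ R₂ r / (2 * r)) +
        segmentMass c d a b R₂ r (k2 R₁ R₂ r / (2 * r))) := by
  have hm1 := measurable_radialDensity a b R₁
  have hm2 := measurable_radialDensity c d R₂
  rw [← lintegral_lensSlice hR₁ hR₂ hr h1 h2,
    ← lintegral_congr fun u => lintegral_radialDensity_mul h1 h2 r u,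
    ← lintegral_plane_eq_lintegral_lintegral (f := fun p =>
      ENNReal.ofReal (radialDensity a b R₁ (p.1 ^ 2 + p.2 ^ 2)) *
        ENNReal.ofReal (radialDensity c d R₂ ((p.1 - r) ^ 2 + p.2 ^ 2))) (by fun_prop)]
  refine lintegral_congr fun x => ?_
  simp [EuclideanSpace.norm_sq_eq, Fin.sum_univ_two]

/-! ### The law of the distance of two independent points with radial densities -/

/-- Polar coordinates for radial integrands. -/
theorem lintegral_plane_norm {f : ℝ → ENNReal} (hf : Measurable f) :
    ∫⁻ x : Plane, f ‖x‖ = ∫⁻ r in Set.Ioi 0, ENNReal.ofReal (2 * Real.pi * r) * f r := by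
  have hdim : Module.finrank ℝ Plane = 2 := finrank_euclideanSpace_fin
  have hval : Measurable fun x : Set.Ioi (0 : ℝ) => f x := hf.comp measurable_subtype_coe
  have hpow : Measurable fun x : Set.Ioi (0 : ℝ) => ENNReal.ofReal ((x : ℝ) ^ 1) := by fun_prop
  calc
    ∫⁻ x : Plane, f ‖x‖ = ∫⁻ x : ({(0)}ᶜ : Set Plane), f ‖x.1‖ ∂(volume.comap Subtype.val) := by
      rw [lintegral_subtype_comap (measurableSet_singleton _).compl fun x : Plane => f ‖x‖,
        restrict_compl_singleton]
    _ = ∫⁻ x, f x.2 ∂(volume : Measure Plane).toSphere.prod (Measure.volumeIoiPow 1) := by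
      have h := (volume : Measure Plane).measurePreserving_homeomorphUnitSphereProd
      rw [hdim] at h
      have h' := h.lintegral_comp (hval.comp measurable_snd)
      simpa using h'
    _ = (∫⁻ x : Set.Ioi (0 : ℝ), f x ∂Measure.volumeIoiPow 1) *
        (volume : Measure Plane).toSphere .univ := by
      rw [lintegral_prod _ (by fun_prop)]
      dsimp only
      rw [lintegral_const]
    _ = (∫⁻ r in Set.Ioi (0 : ℝ), ENNReal.ofReal (r ^ 1) * f r) * ENNReal.ofReal (2 * Real.pi) := by
      rw [Measure.volumeIoiPow, lintegral_withDensity_eq_lintegral_mul _ hpow hval,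
        Measure.toSphere_apply_univ, hdim,
        ← lintegral_subtype_comap measurableSet_Ioi fun r : ℝ => ENNReal.ofReal (r ^ 1) * f r]
      congr 1
      rw [EuclideanSpace.volume_ball_fin_two, ENNReal.ofReal_mul two_pos.le]
      simp
    _ = _ := by
      rw [mul_comm, ← lintegral_const_mul _ (by fun_prop)]
      refine lintegral_congr fun r => ?_
      rw [← mul_assoc, ← ENNReal.ofReal_mul (by positivity), pow_one]

/-- A rotation-invariant overlap integral depends on the shift only through its norm. -/
theorem lintegral_radial_mul_translate_eq (φ ψ : ℝ → ENNReal) {v w : Plane} (h : ‖v‖ = ‖w‖) :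
    ∫⁻ x : Plane, φ ‖x‖ * ψ ‖x - v‖ = ∫⁻ x : Plane, φ ‖x‖ * ψ ‖x - w‖ := by
  -- the reflection exchanging `v` and `w`
  set e := (ℝ ∙ (w - v))ᗮ.reflection
  have hev : e w = v := Submodule.reflection_sub h.symm
  rw [← e.measurePreserving.lintegral_comp_emb e.toHomeomorph.measurableEmbedding]
  refine lintegral_congr fun x => ?_
  rw [← hev, ← map_sub, e.norm_map, e.norm_map]

/-- If the overlap integral `∫ F₁ x * F₂ (x - v)` of the densities of two independent points
is `c ‖v‖`, then their distance has density `2 π r c(r)`: substitute `v = x - y` and use polar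
coordinates for `v`. -/
theorem map_dist_eq_withDensity {Ω : Type*} [MeasurableSpace Ω] {P : Measure Ω}
    [IsProbabilityMeasure P] {X₁ X₂ : Ω → Plane} {F₁ F₂ : Plane → ENNReal} {c : ℝ → ENNReal}
    (hF₁ : Measurable F₁) (hF₂ : Measurable F₂) (hc : Measurable c)
    (hX₁ : HasLaw X₁ (volume.withDensity F₁) P) (hX₂ : HasLaw X₂ (volume.withDensity F₂) P)
    (hindep : IndepFun X₁ X₂ P) (h : ∀ v : Plane, v ≠ 0 → ∫⁻ x, F₁ x * F₂ (x - v) = c ‖v‖) :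
    P.map (fun ω => dist (X₁ ω) (X₂ ω)) = volume.withDensity
      ((Set.Ioi 0).indicator fun r => ENNReal.ofReal (2 * Real.pi * r) * c r) := by
  have hX := hX₁.aemeasurable.prodMk hX₂.aemeasurable
  have hdist : Measurable fun p : Plane × Plane => dist p.1 p.2 := by fun_prop
  refine Measure.ext_of_lintegral _ fun f hf => ?_
  have hfd : Measurable fun p : Plane × Plane => f (dist p.1 p.2) := hf.comp hdist
  have hprod : P.map (fun ω => dist (X₁ ω) (X₂ ω)) =
      ((volume.withDensity F₁).prod (volume.withDensity F₂)).map fun p => dist p.1 p.2 := by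
    rw [← hX₁.map_eq, ← hX₂.map_eq,
      ← (indepFun_iff_map_prod_eq_prod_map_map hX₁.aemeasurable hX₂.aemeasurable).1 hindep,
      AEMeasurable.map_map_of_aemeasurable hdist.aemeasurable hX]
    rfl
  have hind : Measurable ((Set.Ioi 0).indicator fun r => ENNReal.ofReal (2 * Real.pi * r) * c r) :=
    Measurable.indicator (by fun_prop) measurableSet_Ioi
  rw [hprod, lintegral_map hf hdist, lintegral_prod _ hfd.aemeasurable,
    lintegral_withDensity_eq_lintegral_mul _ hF₁
      hfd.lintegral_prod_right',
    lintegral_withDensity_eq_lintegral_mul _ hind hf]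
  calc
    _ = ∫⁻ x, ∫⁻ v, F₁ x * (F₂ (x - v) * f ‖v‖) := by
      refine lintegral_congr fun x => ?_
      rw [Pi.mul_apply, lintegral_const_mul _ (by fun_prop),
        lintegral_withDensity_eq_lintegral_mul _ hF₂ (by fun_prop),
        ← lintegral_sub_left_eq_self _ x]
      simp [dist_eq_norm]
    _ = ∫⁻ v, ∫⁻ x, F₁ x * (F₂ (x - v) * f ‖v‖) :=
      lintegral_lintegral_swap (by fun_prop)
    _ = ∫⁻ v : Plane, c ‖v‖ * f ‖v‖ := by
      refine lintegral_congr_ae ?_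
      filter_upwards [compl_mem_ae_iff.2 (measure_singleton (0 : Plane))] with v hv
      simp_rw [← mul_assoc]
      rw [lintegral_mul_const _ (by fun_prop), h v hv]
    _ = ∫⁻ r in Set.Ioi 0, ENNReal.ofReal (2 * Real.pi * r) * (c r * f r) :=
      lintegral_plane_norm (f := fun r => c r * f r) (by fun_prop)
    _ = _ := by
      rw [← lintegral_indicator measurableSet_Ioi]
      refine lintegral_congr fun r => ?_
      by_cases hr : r ∈ Set.Ioi 0 <;> simp [hr, mul_assoc]

/-! ### The node laws and the closed form -/

/-- The constant coefficient `a` of the density `a + b ‖x‖²` of a node in the disk of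
radius `R`. -/
noncomputable def NodeType.constCoeff : NodeType → ℝ → ℝ
  | .static, R => 1 / (Real.pi * R ^ 2)
  | .mobile, R => 2 / (Real.pi * R ^ 2)

/-- The coefficient `b` of `‖x‖²` in the density `a + b ‖x‖²` of a node in the disk of
radius `R`. -/
noncomputable def NodeType.sqCoeff : NodeType → ℝ → ℝ
  | .static, _ => 0
  | .mobile, R => -(2 / (Real.pi * R ^ 4))

theorem NodeType.density_nonneg (n : NodeType) {R : ℝ} (hR : 0 < R) (t : ℝ) (_ : 0 ≤ t)
    (ht : t ≤ R ^ 2) : 0 ≤ n.constCoeff R + n.sqCoeff R * t := by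
  have := Real.pi_pos
  cases n
  · simp only [constCoeff, sqCoeff, zero_mul, add_zero]
    positivity
  · have h : constCoeff .mobile R + sqCoeff .mobile R * t =
        2 / (Real.pi * R ^ 4) * (R ^ 2 - t) := by
      simp only [constCoeff, sqCoeff]
      field_simp
      ring
    rw [h]
    exact mul_nonneg (by positivity) (by linarith)

theorem nodeLaw_eq_withDensity (n : NodeType) {R : ℝ} (hR : 0 < R) :
    nodeLaw n R = volume.withDensity fun x =>
      ENNReal.ofReal (radialDensity (n.constCoeff R) (n.sqCoeff R) R (‖x‖ ^ 2)) := by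
  have hball : MeasurableSet (Metric.closedBall (0 : Plane) R) := measurableSet_closedBall
  have hind : (fun x : Plane =>
      ENNReal.ofReal (radialDensity (n.constCoeff R) (n.sqCoeff R) R (‖x‖ ^ 2))) =
      (Metric.closedBall (0 : Plane) R).indicator fun x =>
        ENNReal.ofReal (n.constCoeff R + n.sqCoeff R * ‖x‖ ^ 2) := by
    ext x
    have hx : x ∈ Metric.closedBall (0 : Plane) R ↔ ‖x‖ ^ 2 ≤ R ^ 2 := by
      rw [mem_closedBall_zero_iff, sq_le_sq₀ (norm_nonneg x) hR.le]
    by_cases h : ‖x‖ ^ 2 ≤ R ^ 2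
    · rw [Set.indicator_of_mem (hx.2 h), radialDensity, if_pos h]
    · rw [Set.indicator_of_notMem (mt hx.1 h), radialDensity, if_neg h, ENNReal.ofReal_zero]
  rw [hind, withDensity_indicator hball]
  have hpi := Real.pi_pos
  cases n
  · simp only [nodeLaw, staticLaw, NodeType.constCoeff, NodeType.sqCoeff, zero_mul, add_zero,
      withDensity_const, ProbabilityTheory.cond]
    rw [EuclideanSpace.volume_closedBall_fin_two, ← ENNReal.ofReal_pow hR.le,
      ← ENNReal.ofReal_mul (by positivity), ← ENNReal.ofReal_inv_of_pos (by positivity)]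
    congr 2
    rw [one_div, mul_comm]
  · simp only [nodeLaw, rwpLaw]
    congr 1
    ext x
    congr 1
    simp only [rwpDensity, NodeType.constCoeff, NodeType.sqCoeff]
    field_simp
    ring

/-- The integral of the product of the two node densities, with centres at distance `r > 0`, in
its closed form as a sum of two segment masses; see `lintegral_density_mul_translate`. -/
noncomputable def overlap (s : Scenario) (R₁ R₂ r : ℝ) : ℝ :=
  segmentMass (s.node1.constCoeff R₁) (s.node1.sqCoeff R₁) (s.node2.constCoeff R₂)
      (s.node2.sqCoeff R₂) R₁ r (k1 R₁ R₂ r / (2 * r)) +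
    segmentMass (s.node2.constCoeff R₂) (s.node2.sqCoeff R₂) (s.node1.constCoeff R₁)
      (s.node1.sqCoeff R₁) R₂ r (k2 R₁ R₂ r / (2 * r))

theorem overlap_nonneg (s : Scenario) {R₁ R₂ r : ℝ} (hR₁ : 0 < R₁) (hR₂ : 0 < R₂) (hr : 0 < r) :
    0 ≤ overlap s R₁ R₂ r :=
  segmentMass_add_nonneg hR₁ hR₂ hr (s.node1.density_nonneg hR₁) (s.node2.density_nonneg hR₂)

theorem measurable_overlap (s : Scenario) (R₁ R₂ : ℝ) : Measurable (overlap s R₁ R₂) := by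
  have := Real.measurable_arccos
  unfold overlap segmentMass angleCoeff chordCoeff k1 k2
  fun_prop

theorem lintegral_density_mul_translate (s : Scenario) {R₁ R₂ : ℝ} (hR₁ : 0 < R₁) (hR₂ : 0 < R₂)
    {v : Plane} (hv : v ≠ 0) :
    ∫⁻ x : Plane, ENNReal.ofReal
          (radialDensity (s.node1.constCoeff R₁) (s.node1.sqCoeff R₁) R₁ (‖x‖ ^ 2)) *
        ENNReal.ofReal
          (radialDensity (s.node2.constCoeff R₂) (s.node2.sqCoeff R₂) R₂ (‖x - v‖ ^ 2)) =
      ENNReal.ofReal (overlap s R₁ R₂ ‖v‖) := by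
  have hw : ‖v‖ = ‖(!₂[‖v‖, 0] : Plane)‖ := by simp [EuclideanSpace.norm_eq, Fin.sum_univ_two]
  rw [overlap, ← lintegral_radialDensity_mul_translate hR₁ hR₂ (norm_pos_iff.2 hv)
    (s.node1.density_nonneg hR₁) (s.node2.density_nonneg hR₂)]
  exact lintegral_radial_mul_translate_eq
    (fun ρ => ENNReal.ofReal
      (radialDensity (s.node1.constCoeff R₁) (s.node1.sqCoeff R₁) R₁ (ρ ^ 2)))
    (fun ρ => ENNReal.ofReal
      (radialDensity (s.node2.constCoeff R₂) (s.node2.sqCoeff R₂) R₂ (ρ ^ 2))) hw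

/-- Half of the common chord of the two circles, seen from the first centre. -/
theorem sqrt_sq_sub_k1_sq {R₁ R₂ r : ℝ} (hr : 0 < r) :
    √(R₁ ^ 2 - (k1 R₁ R₂ r / (2 * r)) ^ 2) = g3 R₂ R₁ r / (2 * r) := by
  rw [g3, eq_div_iff (by positivity)]
  nth_rewrite 2 [← Real.sqrt_sq (by positivity : 0 ≤ 2 * r)]
  rw [← Real.sqrt_mul' _ (sq_nonneg _)]
  congr 1
  unfold k1
  field_simp
  ring

/-- Half of the common chord of the two circles, seen from the second centre. -/
theorem sqrt_sq_sub_k2_sq {R₁ R₂ r : ℝ} (hr : 0 < r) :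
    √(R₂ ^ 2 - (k2 R₁ R₂ r / (2 * r)) ^ 2) = g3 R₂ R₁ r / (2 * r) := by
  rw [← sqrt_sq_sub_k1_sq hr]
  congr 1
  unfold k1 k2
  field_simp
  ring

theorem sqrt_one_sub_div_sq {R x : ℝ} (hR : 0 < R) (r : ℝ) :
    √(1 - (x / (2 * r * R)) ^ 2) = √(R ^ 2 - (x / (2 * r)) ^ 2) / R := by
  rw [← div_div, show 1 - (x / (2 * r) / R) ^ 2 = (R ^ 2 - (x / (2 * r)) ^ 2) / R ^ 2 by
    rw [sub_div, div_self (by positivity), div_pow (x / (2 * r))],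
    Real.sqrt_div' _ (sq_nonneg R), Real.sqrt_sq hR.le]

theorem distancePDF_eq_overlap (s : Scenario) {R₁ R₂ r : ℝ} (hR₁ : 0 < R₁) (hR₁₂ : R₁ < R₂)
    (hr : 0 < r) : distancePDF s R₁ R₂ r = 2 * Real.pi * r * overlap s R₁ R₂ r := by
  have hR₂ : 0 < R₂ := hR₁.trans hR₁₂
  have hpi := Real.pi_pos
  rw [distancePDF, overlap]
  split_ifs with h h'
  · -- the first disk lies inside the shifted second one
    have h1 : k1 R₁ R₂ r / (2 * r) ≤ -R₁ := by
      rw [div_le_iff₀ (by positivity), k1]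
      nlinarith [h.2]
    have h2 : R₂ ≤ k2 R₁ R₂ r / (2 * r) := by
      rw [le_div_iff₀ (by positivity), k2]
      nlinarith [h.2]
    rw [segmentMass_of_le_neg hR₁ h1, segmentMass_of_le hR₂ h2, angleCoeff]
    cases s <;> simp only [q1, Scenario.node1, Scenario.node2, NodeType.constCoeff,
      NodeType.sqCoeff] <;> field_simp <;> ring
  · -- the circles meet, and both half-chords equal `g3 R₂ R₁ r / (2 * r)`
    rw [segmentMass, segmentMass, sqrt_sq_sub_k1_sq hr, sqrt_sq_sub_k2_sq hr, div_div, div_div]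
    generalize Real.arccos (k1 R₁ R₂ r / (2 * r * R₁)) = θ₁
    generalize Real.arccos (k2 R₁ R₂ r / (2 * r * R₂)) = θ₂
    cases s <;> simp only [q2, q3, q4, Scenario.node1, Scenario.node2, NodeType.constCoeff,
      NodeType.sqCoeff, sqrt_one_sub_div_sq hR₁, sqrt_one_sub_div_sq hR₂, sqrt_sq_sub_k1_sq hr,
      sqrt_sq_sub_k2_sq hr] <;> generalize g3 R₂ R₁ r = g <;>
      simp only [angleCoeff, chordCoeff, k1, k2] <;> field_simp <;> ring
  · -- the disks are disjoint
    have hr' : R₁ + R₂ < r := by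
      by_contra! hle
      exact h' ⟨by by_contra! hlt; exact h ⟨hr.le, hlt⟩, hle⟩
    have h1 : R₁ ≤ k1 R₁ R₂ r / (2 * r) := by
      rw [le_div_iff₀ (by positivity), k1]
      nlinarith
    have h2 : R₂ ≤ k2 R₁ R₂ r / (2 * r) := by
      rw [le_div_iff₀ (by positivity), k2]
      nlinarith
    rw [segmentMass_of_le hR₁ h1, segmentMass_of_le hR₂ h2]
    ring

theorem distancePDF_of_nonpos (s : Scenario) {R₁ R₂ r : ℝ} (hR₁₂ : R₁ < R₂) (hr : r ≤ 0) :
    distancePDF s R₁ R₂ r = 0 := by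
  rw [distancePDF]
  split_ifs with h h'
  · rw [le_antisymm hr h.1]
    simp
  · linarith [h'.1]
  · rfl

end InternodalDistance

open InternodalDistance

theorem theorem1 (s : InternodalDistance.Scenario) (R₁ R₂ : ℝ) (hR₁ : 0 < R₁) (hR₁₂ : R₁ < R₂)
    {Ω : Type*} [MeasurableSpace Ω] (P : Measure Ω) [IsProbabilityMeasure P]
    (X₁ X₂ : Ω → InternodalDistance.Plane)
    (hX₁ : HasLaw X₁ (InternodalDistance.nodeLaw s.node1 R₁) P)
    (hX₂ : HasLaw X₂ (InternodalDistance.nodeLaw s.node2 R₂) P)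
    (hindep : IndepFun X₁ X₂ P) :
    (∀ r : ℝ, 0 ≤ InternodalDistance.distancePDF s R₁ R₂ r) ∧
      HasPDF (fun ω => dist (X₁ ω) (X₂ ω)) P volume ∧
      pdf (fun ω => dist (X₁ ω) (X₂ ω)) P volume =ᵐ[volume]
        fun r => ENNReal.ofReal (InternodalDistance.distancePDF s R₁ R₂ r) := by
  have hR₂ : 0 < R₂ := hR₁.trans hR₁₂
  have hdist : AEMeasurable (fun ω => dist (X₁ ω) (X₂ ω)) P :=
    hX₁.aemeasurable.dist hX₂.aemeasurable
  have hm1 := measurable_radialDensity (s.node1.constCoeff R₁) (s.node1.sqCoeff R₁) R₁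
  have hm2 := measurable_radialDensity (s.node2.constCoeff R₂) (s.node2.sqCoeff R₂) R₂
  have hov := measurable_overlap s R₁ R₂
  rw [nodeLaw_eq_withDensity _ hR₁] at hX₁
  rw [nodeLaw_eq_withDensity _ hR₂] at hX₂
  have hdens : (Set.Ioi 0).indicator (fun r => ENNReal.ofReal (2 * Real.pi * r) *
      ENNReal.ofReal (overlap s R₁ R₂ r)) =
      fun r => ENNReal.ofReal (distancePDF s R₁ R₂ r) := by
    ext r
    rcases le_or_gt r 0 with hr | hr
    · rw [Set.indicator_of_notMem (by simpa using hr), distancePDF_of_nonpos s hR₁₂ hr,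
        ENNReal.ofReal_zero]
    · rw [Set.indicator_of_mem (by simpa using hr), distancePDF_eq_overlap s hR₁ hR₁₂ hr,
        ENNReal.ofReal_mul (p := 2 * Real.pi * r) (by positivity)]
  have hmeas : AEMeasurable (fun r => ENNReal.ofReal (distancePDF s R₁ R₂ r)) volume := by
    rw [← hdens]
    exact (Measurable.indicator (by fun_prop) measurableSet_Ioi).aemeasurable
  have hmap := map_dist_eq_withDensity (c := fun r => ENNReal.ofReal (overlap s R₁ R₂ r))
    (by fun_prop) (by fun_prop) (by fun_prop) hX₁ hX₂ hindep fun v hv =>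
      lintegral_density_mul_translate s hR₁ hR₂ hv
  rw [hdens] at hmap
  have hpdf : HasPDF (fun ω => dist (X₁ ω) (X₂ ω)) P volume :=
    hasPDF_of_map_eq_withDensity hdist _ hmeas hmap
  refine ⟨fun r => ?_, hpdf, (pdf.eq_of_map_eq_withDensity _ hmeas).1 hmap⟩
  rcases le_or_gt r 0 with hr | hr
  · rw [distancePDF_of_nonpos s hR₁₂ hr]
  · rw [distancePDF_eq_overlap s hR₁ hR₁₂ hr]
    exact mul_nonneg (by positivity) (overlap_nonneg s hR₁ hR₂ hr)
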